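/- **Theorem 5.1.** Let $(x^1,x^2)=(x,y)$ and let $J^r$ be the space of $r$-jets of functions $u(x,y)$, with coordinates $(x,y,\lambda_\alpha)$, $|\alpha|\le r$ ($\lambda_0=u$); write $j^ru$ for the lift $\lambda_\alpha=\partial^\alpha u$. Let $U\subset J^r$ be open, let $G$ be $GL(2,\mathbb R)$ or a subgroup of it with Lie algebra $\mathfrak g=\{A:\exp(tA)\in G\ \forall t\in\mathbb R\}$, let $P=U\times G$ be the (trivialized) principal bundle, and let $\tilde\omega=(\tilde\omega^i_j)$ be the $\mathfrak g$-valued form of a smooth principal connection in $P$, with curvature form $\Omega^i_j=d\tilde\omega^i_j+\tilde\omega^i_k\wedge\tilde\omega^k_j$. Let $\Phi(x,y,u,\lambda_j,\lambda_{jk},\dots)=0$ be a differential equation of any order $s$, given by a real function $\Phi$ on a set $W\subset J^s$. A *section* over an open $D\subset\mathbb R^2$ is a smooth $u$ on $D$ with $j^ru(D)\subset U$ and $j^su(D)\subset W$; it is a solution if $\Phi(j^su)=0$ on $D$. Suppose the connection defines a representation of zero curvature for the equation: for every open $D$ and every section $u$ over $D$, the restriction of $\Omega$ to the part of $P$ over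 $j^ru(D)$ vanishes if and only if $u$ is a solution. Let $\tilde\omega^i_j|_{g=1}$ be the connection form in the trivialization, as a matrix-valued one-form on $U$ (its components are the connection coefficients). For $k=1,2$ let $\Gamma_k=(\Gamma^i_{jk})$ be its value on the total derivative $\partial_{x^k}+\sum_{|\alpha|\le r}\lambda_{\alpha k}\,\partial_{\lambda_\alpha}$, that is, its coefficient at $dx^k$ in the coframe formed by $dx^1,dx^2$ and the contact forms $d\lambda_\alpha-\lambda_{\alpha k}dx^k$, $|\alpha|\le r$. Let $\tilde\theta^i=dX^i+X^j\,\tilde\omega^i_j|_{g=1}$ be the forms of the induced connection in the associated bundle $U\times\mathbb R^2$. Then: 1. $\Gamma_1,\Gamma_2$ are smooth and $\mathfrak g$-valued on the part of $J^{r+1}$ over $U$. 2. For every section $u$ over an open $D$, every open $V\subset D$ and every differentiable $X:V\to\mathbb R^2$, the graph of $X$ over $V$ is an integral of the system $\tilde\theta^i|_{j^ru}=0$ if and only if $X$ satisfies on $V$ the Lax system $$X_x=-\Gamma_1(j^{r+1}u)\,X,\qquad X_y=-\Gamma_2(j^{r+1}u)\,X .$$ 3. For every section $u$ over an open $D$,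 the system $\tilde\theta^i|_{j^ru}=0$ is completely integrable on $D\times\mathbb R^2$ (that is, $d\tilde\theta^i=\tilde\theta^k\wedge\eta^i_k$ there for some smooth one-forms $\eta^i_k$) if and only if $u$ is a solution of the equation. 4. For every section $u$ over an open $D$, the Lax system has solutions satisfying any initial conditions (for every convex open $V\subset D$, $p_0\in V$ and $X_0\in\mathbb R^2$ there is a solution $X$ on all of $V$ with $X(p_0)=X_0$) if and only if $u$ is a solution of the equation. -/

import Mathlib

set_option maxSynthPendingDepth 3

open scoped ContDiff

noncomputable section

namespace ZeroCurvature

/-- The base manifold in coordinates `(x, y)`. -/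
abbrev Base : Type := ℝ × ℝ

/-- The two-dimensional linear space carrying the standard representation of `GL(2)`. -/
abbrev Fibre : Type := Fin 2 → ℝ

/-- The algebra `gl(2)` of real `2 × 2` matrices, as the algebra of endomorphisms of `ℝ²` (this one
carries the norm that calculus needs). The matrix entry `A^i_j` is `A e_j i`, and `A X` is the
product of the matrix with the column `X`. -/
abbrev Mat : Type := Fibre →L[ℝ] Fibre

/-- The group `GL(2)` of invertible `2 × 2` matrices. -/
abbrev GL2 : Type := Matˣ

/-! ### Jets of functions of two variables -/

/-- Symmetric multi-indices `(a, b)` of order `a + b ≤ r`; `(a, b)` stands for `a` subscripts `x`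
and `b` subscripts `y`. -/
abbrev MultiIndex (r : ℕ) : Type := {α : ℕ × ℕ // α.1 + α.2 ≤ r}

instance (r : ℕ) : Fintype (MultiIndex r) :=
  Fintype.ofInjective
    (fun α : MultiIndex r =>
      ((⟨α.1.1, by have := α.2; omega⟩, ⟨α.1.2, by have := α.2; omega⟩) : Fin (r + 1) × Fin (r + 1)))
    (by
      intro α β h
      simp only [Prod.mk.injEq, Fin.mk.injEq] at h
      exact Subtype.ext (Prod.ext h.1 h.2))

/-- The coordinate space of the `r`-jets of local sections `u = u(x, y)`: a point is
`((x, y), (λ_α))`, with `|α| ≤ r`, where `λ_(0,0)` is the coordinate `u`. -/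
abbrev Jet (r : ℕ) : Type := Base × (MultiIndex r → ℝ)

/-- The coordinate vector fields `∂_x` (for `k = 0`) and `∂_y` (for `k = 1`) on the base. -/
def basisVec (k : Fin 2) : Base := ![((1 : ℝ), (0 : ℝ)), ((0 : ℝ), (1 : ℝ))] k

/-- The multi-index of order one of the `k`-th variable. -/
def unitIdx (k : Fin 2) : ℕ × ℕ := ![(1, 0), (0, 1)] k

/-- Adding one subscript to a multi-index. -/
def MultiIndex.bump {r : ℕ} (α : MultiIndex r) (k : Fin 2) : MultiIndex (r + 1) :=
  ⟨α.1 + unitIdx k, by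
    have h := α.2
    fin_cases k <;> simp [unitIdx] <;> omega⟩

/-- Partial derivative of a function on the base with respect to the `k`-th variable. -/
def partialDeriv (k : Fin 2) (f : Base → ℝ) : Base → ℝ := fun p => fderiv ℝ f p (basisVec k)

/-- The lift `j^r u` of the section `u` to the jet space:
`λ_(a,b) = ∂_x^a ∂_y^b u`, for `a + b ≤ r`. -/
def jet (r : ℕ) (u : Base → ℝ) (p : Base) : Jet r :=
  (p, fun α => ((partialDeriv 0)^[α.1.1] ((partialDeriv 1)^[α.1.2] u)) p)

/-- The projection from `(r+1)`-jets to `r`-jets. -/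
def jetProj {r : ℕ} (z : Jet (r + 1)) : Jet r :=
  (z.1, fun α => z.2 ⟨α.1, α.2.trans (Nat.le_succ r)⟩)

/-- The total derivative `∂_k + ∑_α λ_{α k} ∂/∂λ_α`, `|α| ≤ r`, at a point of the `(r+1)`-jets,
as a tangent vector to the space of `r`-jets. It is annihilated by all contact forms
`dλ_α - λ_{α k} dx^k`, `|α| ≤ r`, and `dx^l` takes on it the value `δ^l_k`. -/
def totalDeriv {r : ℕ} (k : Fin 2) (z : Jet (r + 1)) : Jet r :=
  (basisVec k, fun α => z.2 (α.bump k))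

/-- `u` is a smooth section over the open set `D` whose `r`-jets lie in `U` and whose `s`-jets lie
in `W`. -/
structure IsSection {r s : ℕ} (U : Set (Jet r)) (W : Set (Jet s)) (u : Base → ℝ) (D : Set Base) :
    Prop where
  isOpen : IsOpen D
  smooth : ContDiffOn ℝ ∞ u D
  mem_left : ∀ p ∈ D, jet r u p ∈ U
  mem_right : ∀ p ∈ D, jet s u p ∈ W

/-- `u` is a solution over `D` of the differential equation
`Φ (x, y, u, u_x, u_y, u_xx, …) = 0` of order at most `s`. -/
def SolvesPDE {s : ℕ} (Φ : Jet s → ℝ) (u : Base → ℝ) (D : Set Base) : Prop :=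
  ∀ p ∈ D, Φ (jet s u p) = 0

/-! ### Vector-valued one-forms -/

section Forms

variable {E E' F : Type*} [NormedAddCommGroup E] [NormedSpace ℝ E] [NormedAddCommGroup E']
  [NormedSpace ℝ E'] [NormedAddCommGroup F] [NormedSpace ℝ F]

/-- Exterior derivative of a one-form, `dη(v, w) = D_v η (w) - D_w η (v)`. -/
def extD (η : E → (E →L[ℝ] F)) (q : E) (v w : E) : F :=
  extDeriv (fun q' => ContinuousAlternatingMap.ofSubsingleton ℝ E F (0 : Fin 1) (η q')) q ![v, w]

/-- Pull-back of a one-form by a map. -/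
def pullback (φ : E' → E) (η : E → (E →L[ℝ] F)) (q : E') : E' →L[ℝ] F :=
  (η (φ q)).comp (fderiv ℝ φ q)

/-- The Pfaffian system `θ = 0`, for the one-forms `θ` with values in `F` (the components of `θ`
are the forms `θ^i`), is completely integrable on `S`: the differentials of the forms lie in the
ideal generated by the forms, that is `dθ^i = θ^k ∧ η^i_k` with smooth one-forms `η^i_k`. -/
def IsCompletelyIntegrable (θ : E → (E →L[ℝ] F)) (S : Set E) : Prop :=
  ∃ η : E → (E →L[ℝ] (F →L[ℝ] F)), ContDiffOn ℝ ∞ η S ∧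
    ∀ q ∈ S, ∀ v w : E, extD θ q v w = η q w (θ q v) - η q v (θ q w)

end Forms

/-! ### Connections in the principal bundle over the jet space -/

/-- The Lie algebra of a subgroup of `GL(2)`: all `A` whose one-parameter group lies in `G`. -/
def lieAlg (G : Subgroup GL2) : Set Mat :=
  {A | ∀ t : ℝ, ∃ g ∈ G, (g : Mat) = NormedSpace.exp (t • A)}

/-- A (principal) connection in the principal bundle `P = U × G` over the region `U` of the jet
space, `G` a subgroup of `GL(2)`, given by its connection form. As usual, the connection form of a
`G`-connection is represented by its unique equivariant extension to `U × GL(2)`, an open subset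
of the vector space `Jet r × Mat`, and it is `gl(2)`-valued there; it is required to restrict to
a form on `P` with values in the Lie algebra of `G`. The right action of `h` is
`(z, g) ↦ (z, g h)`, and the tangent space to `P` at `(z, g)` consists of the
pairs `(ζ, g A)`, `A` in the Lie algebra of `G`. -/
structure PrincipalConnection (G : Subgroup GL2) {r : ℕ} (U : Set (Jet r)) where
  /-- the connection form -/
  form : Jet r × Mat → (Jet r × Mat →L[ℝ] Mat)
  smooth : ContDiffOn ℝ ∞ form (U ×ˢ {g : Mat | IsUnit g})
  /-- The form reproduces the generators of the fundamental vertical vector fields. -/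
  vertical : ∀ z ∈ U, ∀ (g : GL2) (A : Mat), form (z, (g : Mat)) (0, (g : Mat) * A) = A
  /-- The form is equivariant, `R_h^* ω = Ad(h⁻¹) ω`. -/
  equivariant : ∀ z ∈ U, ∀ (g h : GL2) (ζ : Jet r) (B : Mat),
    form (z, (g : Mat) * (h : Mat)) (ζ, B * (h : Mat)) =
      ((h⁻¹ : GL2) : Mat) * form (z, (g : Mat)) (ζ, B) * (h : Mat)
  /-- On tangent vectors to `U × G` the form takes its values in the Lie algebra of `G`. -/
  reduces : ∀ z ∈ U, ∀ g ∈ G, ∀ (ζ : Jet r), ∀ A ∈ lieAlg G,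
    form (z, (g : Mat)) (ζ, (g : Mat) * A) ∈ lieAlg G

section Connection

variable {G : Subgroup GL2} {r : ℕ} {U : Set (Jet r)}

/-- The curvature form `Ω = dω + ½ [ω ∧ ω]`, in components `Ω^i_j = dω^i_j + ω^i_k ∧ ω^k_j`. -/
def curvature (ϖ : PrincipalConnection G U) (q : Jet r × Mat) (v w : Jet r × Mat) : Mat :=
  extD ϖ.form q v w + (ϖ.form q v * ϖ.form q w - ϖ.form q w * ϖ.form q v)

/-- The curvature form vanishes on the lift of the section `u` over `D`: its restriction to the
part of `P` lying over `{j^r u (p) | p ∈ D}` is zero. -/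
def CurvatureVanishesOn (ϖ : PrincipalConnection G U) (u : Base → ℝ) (D : Set Base) : Prop :=
  ∀ p ∈ D, ∀ g ∈ G, ∀ v w : Base, ∀ A ∈ lieAlg G, ∀ B ∈ lieAlg G,
    curvature ϖ (jet r u p, (g : Mat))
      (fderiv ℝ (jet r u) p v, (g : Mat) * A) (fderiv ℝ (jet r u) p w, (g : Mat) * B) = 0

/-- The connection defines a representation of zero curvature for the equation `Φ = 0` (a relation
on the region `W` of the `s`-jets): the curvature form vanishes on the lifts of the solutions, and
only on the lifts of solutions. -/
def IsZeroCurvatureRep (ϖ : PrincipalConnection G U) {s : ℕ} (W : Set (Jet s)) (Φ : Jet s → ℝ) :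
    Prop :=
  ∀ (u : Base → ℝ) (D : Set Base), IsSection U W u D →
    (CurvatureVanishesOn ϖ u D ↔ SolvesPDE Φ u D)

/-- The connection coefficients at `z`: the connection form in the trivialization of `P`, read as a
matrix-valued one-form on the jet space, whose value on `∂/∂z^ε` is the matrix
`(Γ^i_{jε})` with row `i` and column `j`. -/
def connCoeff (ϖ : PrincipalConnection G U) (z : Jet r) : Jet r →L[ℝ] Mat :=
  (ϖ.form (z, 1)).comp (ContinuousLinearMap.inl ℝ (Jet r) Mat)

/-- The matrix `Γ_k = (Γ^i_{jk})` of the connection coefficients that belong to `dx^k` in the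
coframe of the `dx^l` and the contact forms. -/
def laxCoeff (ϖ : PrincipalConnection G U) (k : Fin 2) (z : Jet (r + 1)) : Mat :=
  connCoeff ϖ (jetProj z) (totalDeriv k z)

/-- The connection forms `θ^i = dX^i + X^j ω^i_j` of the induced connection in the associated bundle
`U × ℝ²`. -/
def assocForm (ϖ : PrincipalConnection G U) (q : Jet r × Fibre) : Jet r × Fibre →L[ℝ] Fibre :=
  ContinuousLinearMap.snd ℝ (Jet r) Fibre +
    (ContinuousLinearMap.apply ℝ Fibre q.2).comp ((connCoeff ϖ q.1).comp (ContinuousLinearMap.fst ℝ (Jet r) Fibre))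

/-- The restriction of the forms `θ^i` to the lift of the section `u`, as forms in `(x, y, X)`. -/
def assocFormOn (ϖ : PrincipalConnection G U) (u : Base → ℝ) :
    Base × Fibre → (Base × Fibre →L[ℝ] Fibre) :=
  pullback (fun q : Base × Fibre => (jet r u q.1, q.2)) (assocForm ϖ)

/-- `X` solves on `V` the Lax system `X_x = -Γ_1 X`, `X_y = -Γ_2 X` of the section `u`. -/
def SolvesLax (ϖ : PrincipalConnection G U) (u : Base → ℝ) (V : Set Base) (X : Base → Fibre) :
    Prop :=
  ∀ p ∈ V, DifferentiableAt ℝ X p ∧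
    ∀ k : Fin 2, fderiv ℝ X p (basisVec k) = -(laxCoeff ϖ k (jet (r + 1) u p) (X p))

/-- The Lax system of `u` has solutions satisfying any initial conditions: on every convex open
subset `V` of `D`, for each point of `V` and each value prescribed there, some solution on all of
`V` takes that value. -/
def LaxSolvableForAllData (ϖ : PrincipalConnection G U) (u : Base → ℝ) (D : Set Base) : Prop :=
  ∀ V ⊆ D, IsOpen V → Convex ℝ V → ∀ p₀ ∈ V, ∀ X₀ : Fibre,
    ∃ X : Base → Fibre, X p₀ = X₀ ∧ SolvesLax ϖ u V X

end Connection

end ZeroCurvature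

end

open ZeroCurvature

noncomputable section

namespace ZeroCurvature

open Set Filter Topology

/-! ### Exterior derivatives and pull-backs -/

section Forms

variable {E E' F : Type*} [NormedAddCommGroup E] [NormedSpace ℝ E] [NormedAddCommGroup E']
  [NormedSpace ℝ E'] [NormedAddCommGroup F] [NormedSpace ℝ F]

/-! A section `u` pulls the connection coefficients back along its lift to a matrix-valued one-form
`a` on `D` (`sectionForm`), the form of a linear connection over the base. Every condition in the
theorem becomes flatness of this connection, `F = da + a ∧ a = 0`; the zero-curvature hypothesis
then exchanges flatness for being a solution.

Curvature: equivariance and the vertical normalization force `ω = g⁻¹ Γ g + g⁻¹ dg`, hence `Ω = g⁻¹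
(dΓ + Γ ∧ Γ) g` (`curvature_apply`). Exterior derivatives commute with pull-back (`extD_pullback`),
so `Ω` vanishes over the lift iff `F = 0`.

Integrability: `dθ` is `F X` plus terms in the ideal of `θ` (`extD_linearForm`), and horizontal
vectors isolate `F X`.

Lax system: the lift is tangent to the total derivatives (`fderiv_jet_basisVec`), so the system is
`dX = -a X`. Symmetry of the second derivative of a solution gives `F X = 0` at each value it takes,
and the initial values are arbitrary. Conversely, on a convex set one transports `X₀` along the rays
from `p₀`; flatness makes the result parallel in all directions
(`hasFDerivAt_of_radially_parallel`). -/

theorem extD_apply {η : E → (E →L[ℝ] F)} {q : E} (hη : DifferentiableAt ℝ η q) (v w : E) :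
    extD η q v w = fderiv ℝ η q v w - fderiv ℝ η q w v := by
  have hd : DifferentiableAt ℝ
      (fun q' => ContinuousAlternatingMap.ofSubsingleton ℝ E F (0 : Fin 1) (η q')) q :=
    ((ContinuousAlternatingMap.ofSubsingletonLIE (𝕜 := ℝ) (E := E) (F := F) (0 : Fin 1)).toContinuousLinearEquiv
      |>.differentiableAt).comp q hη
  have key : ∀ x y : E, fderiv ℝ (fun q' => η q' x) q y = fderiv ℝ η q y x := fun x y => by
    rw [fderiv_clm_apply hη (differentiableAt_const x)]
    simp
  unfold extD
  rw [extDeriv_apply hd]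
  simp [Fin.sum_univ_two, Fin.removeNth, key, sub_eq_add_neg]

theorem extD_congr {η η' : E → (E →L[ℝ] F)} {q : E} (h : η =ᶠ[𝓝 q] η') (v w : E) :
    extD η q v w = extD η' q v w := by
  unfold extD
  rw [Filter.EventuallyEq.extDeriv_eq]
  filter_upwards [h] with x hx
  rw [hx]

theorem pullback_differentiableAt {φ : E' → E} {η : E → (E →L[ℝ] F)} {q : E'}
    (hφ : ContDiffAt ℝ 2 φ q) (hη : DifferentiableAt ℝ η (φ q)) :
    DifferentiableAt ℝ (pullback φ η) q :=
  (hη.comp q (hφ.differentiableAt (by norm_num))).clm_comp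
    ((hφ.fderiv_right (m := 1) (by norm_num)).differentiableAt (by norm_num))

/-- Naturality of `d`: the second derivative of `φ` is symmetric, so its contribution cancels on
antisymmetrizing. -/
theorem extD_pullback {φ : E' → E} {η : E → (E →L[ℝ] F)} {q : E'}
    (hφ : ContDiffAt ℝ 2 φ q) (hη : DifferentiableAt ℝ η (φ q)) (v w : E') :
    extD (pullback φ η) q v w = extD η (φ q) (fderiv ℝ φ q v) (fderiv ℝ φ q w) := by
  have h1 : HasFDerivAt φ (fderiv ℝ φ q) q := (hφ.differentiableAt (by norm_num)).hasFDerivAt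
  have h2 : HasFDerivAt (fderiv ℝ φ) (fderiv ℝ (fderiv ℝ φ) q) q :=
    ((hφ.fderiv_right (m := 1) (by norm_num)).differentiableAt (by norm_num)).hasFDerivAt
  have hsymm : fderiv ℝ (fderiv ℝ φ) q v w = fderiv ℝ (fderiv ℝ φ) q w v :=
    hφ.isSymmSndFDerivAt (by simp) v w
  have h3 := ((hη.hasFDerivAt.comp q h1).clm_comp h2).fderiv
  rw [extD_apply (pullback_differentiableAt hφ hη), extD_apply hη]
  have h4 : fderiv ℝ (pullback φ η) q = _ := h3
  rw [h4]
  simp [hsymm]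

/-- The curvature `da + ½ [a ∧ a]` of a one-form with values in an algebra. -/
def formCurvature {A : Type*} [NormedRing A] [NormedAlgebra ℝ A] (a : E → (E →L[ℝ] A)) (p v w : E) :
    A :=
  extD a p v w + (a p v * a p w - a p w * a p v)

theorem formCurvature_pullback {A : Type*} [NormedRing A] [NormedAlgebra ℝ A] {φ : E' → E}
    {a : E → (E →L[ℝ] A)} {q : E'}
    (hφ : ContDiffAt ℝ 2 φ q) (ha : DifferentiableAt ℝ a (φ q)) (v w : E') :
    formCurvature (pullback φ a) q v w =
      formCurvature a (φ q) (fderiv ℝ φ q v) (fderiv ℝ φ q w) := by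
  simp only [formCurvature, extD_pullback hφ ha, pullback, ContinuousLinearMap.comp_apply]

/-- The form `dX + a X` of the linear connection with connection form `a`. -/
def linearForm (a : E → (E →L[ℝ] (F →L[ℝ] F))) (q : E × F) : E × F →L[ℝ] F :=
  ContinuousLinearMap.snd ℝ E F +
    (ContinuousLinearMap.apply ℝ F q.2).comp ((a q.1).comp (ContinuousLinearMap.fst ℝ E F))

@[simp]
theorem linearForm_apply (a : E → (E →L[ℝ] (F →L[ℝ] F))) (q V : E × F) :
    linearForm a q V = V.2 + a q.1 V.1 q.2 := by
  simp [linearForm]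

/-- The structure equation `dθ = F X - a ∧ θ`: replacing `dX` by `θ - a X` in `d(a X)` turns the
quadratic remainder into the `a ∧ a` part of the curvature. -/
theorem extD_linearForm {a : E → (E →L[ℝ] (F →L[ℝ] F))} {q : E × F}
    (ha : DifferentiableAt ℝ a q.1) (V W : E × F) :
    extD (linearForm a) q V W = formCurvature a q.1 V.1 W.1 q.2 +
      (a q.1 W.1 (linearForm a q V) - a q.1 V.1 (linearForm a q W)) := by
  have hsnd : HasFDerivAt (fun q' : E × F => ContinuousLinearMap.apply ℝ F q'.2)
      ((ContinuousLinearMap.apply ℝ F).comp (ContinuousLinearMap.snd ℝ E F)) q :=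
    ((ContinuousLinearMap.apply ℝ F).comp (ContinuousLinearMap.snd ℝ E F)).hasFDerivAt
  have hfst : HasFDerivAt (fun q' : E × F => a q'.1)
      ((fderiv ℝ a q.1).comp (ContinuousLinearMap.fst ℝ E F)) q :=
    ha.hasFDerivAt.comp q hasFDerivAt_fst
  have h := (hsnd.clm_comp (hfst.clm_comp
    (hasFDerivAt_const (ContinuousLinearMap.fst ℝ E F) q))).const_add
      (ContinuousLinearMap.snd ℝ E F)
  have hd : DifferentiableAt ℝ (linearForm a) q := h.differentiableAt
  have hf : fderiv ℝ (linearForm a) q = _ := h.fderiv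
  rw [extD_apply hd, hf]
  simp [formCurvature, extD_apply ha]
  abel

/-- A linear connection is completely integrable exactly if it is flat. -/
theorem isCompletelyIntegrable_linearForm_iff {a : E → (E →L[ℝ] (F →L[ℝ] F))} {D : Set E}
    (hD : IsOpen D) (ha : ContDiffOn ℝ ∞ a D) :
    IsCompletelyIntegrable (linearForm a) (D ×ˢ univ) ↔
      ∀ p ∈ D, ∀ v w : E, formCurvature a p v w = 0 := by
  have had : ∀ p ∈ D, DifferentiableAt ℝ a p := fun p hp =>
    (ha.contDiffAt (hD.mem_nhds hp)).differentiableAt (by simp)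
  constructor
  · rintro ⟨η, -, h⟩ p hp v w
    ext1 X
    -- These are the horizontal lifts of `v` and `w` at `X`. Both forms vanish on them, so only the
    -- curvature term survives.
    have := h (p, X) ⟨hp, mem_univ _⟩ (v, -(a p v X)) (w, -(a p w X))
    rw [extD_linearForm (had p hp)] at this
    simpa using this
  · intro h
    refine ⟨fun q => (a q.1).comp (ContinuousLinearMap.fst ℝ E F), ?_, ?_⟩
    · exact (ha.comp contDiff_fst.contDiffOn (fun q hq => hq.1)).clm_comp contDiffOn_const
    · rintro q ⟨hq, -⟩ V W
      rw [extD_linearForm (had _ hq), h _ hq]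
      simp

/-- A value taken by a parallel section is annihilated by the curvature. -/
theorem formCurvature_apply_eq_zero {a : E → (E →L[ℝ] (F →L[ℝ] F))} {X : E → F} {p : E}
    (ha : DifferentiableAt ℝ a p)
    (hX : ∀ᶠ q in 𝓝 p, HasFDerivAt X (-(a q).flip (X q)) q) (v w : E) :
    formCurvature a p v w (X p) = 0 := by
  have hXp := hX.self_of_nhds
  have hflip : HasFDerivAt (fun q => (a q).flip)
      ((ContinuousLinearMap.flipₗᵢ ℝ E F F : (E →L[ℝ] F →L[ℝ] F) →L[ℝ] (F →L[ℝ] E →L[ℝ] F)).comp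
        (fderiv ℝ a p)) p :=
    ((ContinuousLinearMap.flipₗᵢ ℝ E F F :
      (E →L[ℝ] F →L[ℝ] F) →L[ℝ] (F →L[ℝ] E →L[ℝ] F)).hasFDerivAt).comp p ha.hasFDerivAt
  have h2 := (hflip.clm_apply hXp).neg
  -- Differentiating `dX = -a X` once more, and substituting the equation for `dX`, expresses the
  -- second derivative through `da` and `a a`. Its antisymmetric part is the curvature applied to `X
  -- p`, up to sign.
  have h3 := second_derivative_symmetric_of_eventually hX h2 v w
  simp at h3
  simp only [formCurvature, extD_apply ha]
  simp
  rw [← sub_eq_zero] at h3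
  rw [← neg_eq_zero, ← h3]
  abel

end Forms

/-! ### Linear ordinary differential equations -/

section ODE

variable {ι : Type*} [Fintype ι]

/-- A linear differential equation with continuous coefficients has solutions on the whole
interval. -/
theorem exists_linear_ode (B : ℝ → (ι → ℝ) →L[ℝ] (ι → ℝ)) (hB : ContinuousOn B (Icc 0 1))
    (x₀ : ι → ℝ) : ∃ α : ℝ → ι → ℝ, α 0 = x₀ ∧
      ∀ t ∈ Icc (0 : ℝ) 1, HasDerivWithinAt α (B t (α t)) (Icc 0 1) t := by
  obtain ⟨M, hM⟩ := isCompact_Icc.exists_bound_of_continuousOn hB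
  have hM0 : 0 ≤ M := (norm_nonneg _).trans (hM 0 (by simp))
  -- `R` is the a priori Grönwall bound on `[0, 1]`. Truncating the argument coordinatewise to `[-R,
  -- R]` by `c` bounds the field by `M * R`, so one application of Picard–Lindelöf covers the whole
  -- interval. As `c` does not increase norms, the truncated solution obeys the same Grönwall bound,
  -- and the truncation never acts on it.
  set R : ℝ := ‖x₀‖ * Real.exp M with hR
  have hR0 : 0 ≤ R := by positivity
  let c : (ι → ℝ) → ι → ℝ := fun x i => (projIcc (-R) R (by linarith) (x i) : ℝ)
  have hcle : ∀ x, ‖c x‖ ≤ R := fun x => by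
    refine (pi_norm_le_iff_of_nonneg hR0).2 fun i => ?_
    exact abs_le.2 (projIcc (-R) R (by linarith) (x i)).2
  have hclip : LipschitzWith 1 c := by
    refine LipschitzWith.of_dist_le_mul fun x y => ?_
    rw [NNReal.coe_one, one_mul]
    refine (dist_pi_le_iff dist_nonneg).2 fun i => ?_
    refine le_trans ?_ (dist_le_pi_dist x y i)
    have := (LipschitzWith.projIcc (a := -R) (b := R) (by linarith)).dist_le_mul (x i) (y i)
    rwa [NNReal.coe_one, one_mul] at this
  have hcid : ∀ x, ‖x‖ ≤ R → c x = x := fun x hx => by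
    ext i
    have hi := abs_le.1 ((norm_le_pi_norm x i).trans hx)
    simp only [c]
    rw [projIcc_of_mem _ ⟨hi.1, hi.2⟩]
  have hcnorm : ∀ x, ‖c x‖ ≤ ‖x‖ := fun x => by
    have h0 : c 0 = 0 := hcid 0 (by simpa using hR0)
    have := hclip.dist_le_mul x 0
    simpa [h0] using this
  -- The ball of radius `M * R` suffices: the speed is at most `M * R` and the time at most `1`.
  have hpl : IsPicardLindelof (fun t x => B t (c x)) (tmin := 0) (tmax := 1) ⟨0, by simp⟩ x₀
      ⟨M * R, by positivity⟩ 0 ⟨M * R, by positivity⟩ ⟨M, hM0⟩ := by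
    refine ⟨fun t ht => ?_, fun x _ => ?_, fun t ht x _ => ?_, ?_⟩
    · refine LipschitzWith.lipschitzOnWith (LipschitzWith.of_dist_le_mul fun x y => ?_)
      rw [dist_eq_norm, ← map_sub]
      refine (ContinuousLinearMap.le_opNorm _ _).trans ?_
      have := hclip.dist_le_mul x y
      rw [NNReal.coe_one, one_mul, dist_eq_norm] at this
      exact mul_le_mul (hM t ht) this (norm_nonneg _) hM0
    · exact hB.clm_apply continuousOn_const
    · exact (ContinuousLinearMap.le_opNorm _ _).trans
        (mul_le_mul (hM t ht) (hcle x) (norm_nonneg _) hM0)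
    · simp
  obtain ⟨α, hα0, hα⟩ := hpl.exists_eq_forall_mem_Icc_hasDerivWithinAt₀
  have hα0' : α 0 = x₀ := hα0
  have hαle : ∀ t ∈ Icc (0 : ℝ) 1, ‖α t‖ ≤ R := fun t ht => by
    have := norm_le_gronwallBound_of_norm_deriv_right_le (f := α) (f' := fun t => B t (c (α t)))
      (δ := ‖x₀‖) (K := M) (ε := 0) (a := 0) (b := 1) (fun t ht => (hα t ht).continuousWithinAt)
      (fun t ht => (hα t (Ico_subset_Icc_self ht)).mono_of_mem_nhdsWithin
        (Icc_mem_nhdsGE_of_mem ht)) (by rw [hα0'])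
      (fun t ht => by
        rw [add_zero]
        exact (ContinuousLinearMap.le_opNorm _ _).trans (mul_le_mul
          (hM t (Ico_subset_Icc_self ht)) (hcnorm _) (norm_nonneg _) hM0)) t ht
    rw [gronwallBound_ε0, sub_zero] at this
    refine this.trans (mul_le_mul_of_nonneg_left (Real.exp_le_exp.2 ?_) (norm_nonneg _))
    exact mul_le_of_le_one_right hM0 ht.2
  refine ⟨α, hα0', fun t ht => ?_⟩
  have := hα t ht
  rwa [hcid _ (hαle t ht)] at this

end ODE

/-! ### Parallel sections of flat linear connections -/

section Parallel

variable {E F : Type*} [NormedAddCommGroup E] [NormedSpace ℝ E] [NormedAddCommGroup F]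
  [NormedSpace ℝ F]

/-- A `C¹` function is differentiable uniformly along a compact set. -/
theorem uniform_taylor_on_compact {a : E → F} {V K : Set E} (hV : IsOpen V) (hVc : Convex ℝ V)
    (ha : ContDiffOn ℝ 1 a V) (hK : IsCompact K) (hKV : K ⊆ V) {ε : ℝ} (hε : 0 < ε) :
    ∃ δ > 0, ∀ c ∈ K, ∀ h : E, c + h ∈ V → ‖h‖ < δ →
      ‖a (c + h) - a c - fderiv ℝ a c h‖ ≤ ε * ‖h‖ := by
  have hcont : ∀ c ∈ K, ContinuousAt (fderiv ℝ a) c := fun c hc =>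
    ((ha.contDiffAt (hV.mem_nhds (hKV hc))).fderiv_right (m := 0) (by simp)).continuousAt
  -- Only one of the two points compared has to lie in `K`; this matters because `c + h` may leave
  -- `K`.
  have hunif := hK.uniformContinuousAt_of_continuousAt (fderiv ℝ a) hcont
    (Metric.dist_mem_uniformity hε)
  obtain ⟨δ, hδ, hsub⟩ := Metric.mem_uniformity_dist.1 hunif
  refine ⟨δ, hδ, fun c hc h hch hh => ?_⟩
  have hcV := hKV hc
  have hseg : segment ℝ c (c + h) ⊆ V := hVc.segment_subset hcV hch
  have := (convex_segment c (c + h)).norm_image_sub_le_of_norm_hasFDerivWithin_le' (f := a)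
    (f' := fderiv ℝ a) (φ := fderiv ℝ a c) (C := ε) (x := c) (y := c + h)
    (fun x hx => ((ha.contDiffAt (hV.mem_nhds (hseg hx))).differentiableAt
      (by norm_num)).hasFDerivAt.hasFDerivWithinAt)
    (fun x hx => by
      have hd : dist c x < δ := by
        refine lt_of_le_of_lt ?_ hh
        have := norm_sub_le_of_mem_segment hx
        rw [dist_eq_norm, norm_sub_rev]
        simpa using this
      have h5 := @hsub c x hd hc
      rw [← dist_eq_norm, dist_comm]
      exact h5.le)
    (left_mem_segment ℝ _ _) (right_mem_segment ℝ _ _)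
  simpa using this

theorem norm_smul_le_of_mem_unitInterval {t : ℝ} (ht : t ∈ Icc (0 : ℝ) 1) (x : F) :
    ‖t • x‖ ≤ ‖x‖ := by
  rw [norm_smul, Real.norm_eq_abs, abs_of_nonneg ht.1]
  exact mul_le_of_le_one_left (norm_nonneg _) ht.2

/-- How far the first-order candidate `Y - t a(v) Y` is from being parallel in the direction
`d + v`, where `a` is the connection form, `D` its derivative, `a'` its value at the displacement
`t v`, and `Y` is parallel in the direction `d`. -/
theorem norm_parallel_defect_le {a a' : E →L[ℝ] F →L[ℝ] F} {D : E →L[ℝ] E →L[ℝ] F →L[ℝ] F}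
    {d v : E} {Y : F} {t A C M L ε : ℝ} (ht : t ∈ Icc (0 : ℝ) 1)
    (hflat : D v d - D d v + (a v * a d - a d * a v) = 0)
    (hA : ‖a‖ ≤ A) (hC : ‖D‖ ≤ C) (hM : ‖Y‖ ≤ M) (hL : ‖d‖ ≤ L) (hv : ‖v‖ ≤ ε) (hε : ε ≤ 1)
    (ha' : ‖a' - a - D (t • v)‖ ≤ ε * ‖t • v‖) :
    ‖-(a d Y) - a v Y - t • D d v Y + t • a v (a d Y) + a' (d + v) (Y - t • a v Y)‖ ≤
      ((L + 1) * (M + A * M) + A * A * M + C * M + C * (L + 1) * (A * M)) * (ε * ‖v‖) := by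
  obtain ⟨ρ, hρ⟩ : ∃ ρ, ρ = a' - a - D (t • v) := ⟨_, rfl⟩
  have ha'eq : a' = a + t • D v + ρ := by rw [hρ, map_smul]; abel
  have hflatY : D d v Y = D v d Y + (a v (a d Y) - a d (a v Y)) := by
    have := congrArg (fun T : F →L[ℝ] F => T Y) hflat
    simp at this
    rw [← sub_eq_zero, ← neg_eq_zero, ← this]
    abel
  -- The terms of order zero in `v` cancel, and so do those of order one, the latter by flatness.
  -- What remains contains the Taylor remainder `ρ` or is at least quadratic in `v`, and `‖v‖ ≤ ε`
  -- makes it `O(ε ‖v‖)`.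
  have hid : -(a d Y) - a v Y - t • D d v Y + t • a v (a d Y) + a' (d + v) (Y - t • a v Y) =
      ρ (d + v) (Y - t • a v Y) - t • a v (a v Y) + t • D v v Y
        - t • t • D v (d + v) (a v Y) := by
    rw [ha'eq, hflatY]
    simp
    module
  rw [← hρ] at ha'
  rw [hid]
  have hA0 := (norm_nonneg _).trans hA
  have hC0 := (norm_nonneg _).trans hC
  have hM0 := (norm_nonneg _).trans hM
  have hL0 := (norm_nonneg _).trans hL
  have hε0 := (norm_nonneg _).trans hv
  have hsm : ∀ x : F, ‖t • x‖ ≤ ‖x‖ := norm_smul_le_of_mem_unitInterval ht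
  have hdv : ‖d + v‖ ≤ L + 1 := (norm_add_le _ _).trans (add_le_add hL (hv.trans hε))
  have hav : ‖a v‖ ≤ A * ‖v‖ := a.le_of_opNorm_le hA v
  have havY : ‖a v Y‖ ≤ A * ‖v‖ * M := (a v).le_of_opNorm_le_of_le hav hM
  have hDv : ‖D v‖ ≤ C * ‖v‖ := D.le_of_opNorm_le hC v
  have h1 : ‖ρ (d + v) (Y - t • a v Y)‖ ≤ ε * ‖v‖ * (L + 1) * (M + A * M) := by
    have hρn : ‖ρ‖ ≤ ε * ‖v‖ := ha'.trans
      (mul_le_mul_of_nonneg_left (norm_smul_le_of_mem_unitInterval ht v) hε0)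
    refine (ρ (d + v)).le_of_opNorm_le_of_le (ρ.le_of_opNorm_le_of_le hρn hdv) ?_
    refine (norm_sub_le _ _).trans (add_le_add hM ((hsm _).trans (havY.trans ?_)))
    exact mul_le_mul_of_nonneg_right (mul_le_of_le_one_right hA0 (hv.trans hε)) hM0
  have h2 : ‖t • a v (a v Y)‖ ≤ A * ‖v‖ * (A * ε * M) :=
    (hsm _).trans ((a v).le_of_opNorm_le_of_le hav (havY.trans (by gcongr)))
  have h3 : ‖t • D v v Y‖ ≤ C * ‖v‖ * ε * M :=
    (hsm _).trans ((D v v).le_of_opNorm_le_of_le ((D v).le_of_opNorm_le_of_le hDv hv) hM)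
  have h4 : ‖t • t • D v (d + v) (a v Y)‖ ≤ C * ‖v‖ * (L + 1) * (A * ε * M) :=
    (hsm _).trans ((hsm _).trans ((D v (d + v)).le_of_opNorm_le_of_le
      ((D v).le_of_opNorm_le_of_le hDv hdv) (havY.trans (by gcongr))))
  refine (norm_sub_le_of_le (norm_add_le_of_le (norm_sub_le_of_le h1 h2) h3) h4).trans
    (le_of_eq (by ring))

/-- Parallel transport along the rays from `p₀` in a flat linear connection is differentiable in
the end point, and yields a parallel section. -/
theorem hasFDerivAt_of_radially_parallel {a : E → (E →L[ℝ] (F →L[ℝ] F))} {V : Set E}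
    (hV : IsOpen V) (hVc : Convex ℝ V) (ha : ContDiffOn ℝ 1 a V)
    (hflat : ∀ p ∈ V, ∀ v w : E, formCurvature a p v w = 0) {p₀ : E} (hp₀ : p₀ ∈ V) {X₀ : F}
    {Y : E → ℝ → F} (hY0 : ∀ p ∈ V, Y p 0 = X₀)
    (hY : ∀ p ∈ V, ∀ t ∈ Icc (0 : ℝ) 1,
      HasDerivWithinAt (Y p) (-(a (p₀ + t • (p - p₀)) (p - p₀) (Y p t))) (Icc 0 1) t)
    {p : E} (hp : p ∈ V) :
    HasFDerivAt (fun q => Y q 1) (-(a p).flip (Y p 1)) p := by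
  have hc : ∀ q ∈ V, ∀ t ∈ Icc (0 : ℝ) 1, p₀ + t • (q - p₀) ∈ V := fun q hq t ht =>
    hVc.add_smul_sub_mem hp₀ hq ht
  have had : ∀ q ∈ V, HasFDerivAt a (fderiv ℝ a q) q := fun q hq =>
    ((ha.contDiffAt (hV.mem_nhds hq)).differentiableAt (by norm_num)).hasFDerivAt
  set d : E := p - p₀ with hd
  let c : ℝ → E := fun t => p₀ + t • d
  have hcc : Continuous c := by fun_prop
  have hcV : ∀ t ∈ Icc (0 : ℝ) 1, c t ∈ V := hc p hp
  have hK : IsCompact (c '' Icc 0 1) := isCompact_Icc.image hcc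
  have hKV : c '' Icc 0 1 ⊆ V := by
    rintro _ ⟨t, ht, rfl⟩
    exact hcV t ht
  obtain ⟨A, hA⟩ := hK.exists_bound_of_continuousOn (ha.continuousOn.mono hKV)
  obtain ⟨C, hC⟩ := hK.exists_bound_of_continuousOn
    ((ha.continuousOn_fderiv_of_isOpen hV le_rfl).mono hKV)
  obtain ⟨M, hM⟩ := isCompact_Icc.exists_bound_of_continuousOn
    (fun t ht => (hY p hp t ht).continuousWithinAt)
  have h01 : (0 : ℝ) ∈ Icc (0 : ℝ) 1 := by simp
  have h11 : (1 : ℝ) ∈ Icc (0 : ℝ) 1 := by simp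
  have hA0 : 0 ≤ A := (norm_nonneg _).trans (hA _ (mem_image_of_mem c h01))
  have hC0 : 0 ≤ C := (norm_nonneg _).trans (hC _ (mem_image_of_mem c h01))
  have hM0 : 0 ≤ M := (norm_nonneg _).trans (hM _ h01)
  obtain ⟨L, hL⟩ : ∃ L, L = ‖d‖ := ⟨_, rfl⟩
  have hL0 : 0 ≤ L := hL ▸ norm_nonneg d
  obtain ⟨κ, hκ⟩ : ∃ κ, κ = (L + 1) * (M + A * M) + A * A * M + C * M + C * (L + 1) * (A * M) :=
    ⟨_, rfl⟩
  have hκ0 : 0 ≤ κ := by rw [hκ]; positivity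
  -- `k` will bound the coefficient of the transport equation along the displaced ray: `A + C + 1`
  -- for the form (value, derivative, Taylor remainder) and `L + 1` for the direction `d + v`. The
  -- constant `T` below is the Grönwall factor at time `1` for rate `k` and defect `κ`.
  obtain ⟨k, hk⟩ : ∃ k, k = (A + C + 1) * (L + 1) := ⟨_, rfl⟩
  have hk0 : 0 < k := by rw [hk]; positivity
  rw [hasFDerivAt_iff_isLittleO_nhds_zero, Asymptotics.isLittleO_iff]
  intro η hη
  obtain ⟨T, hT⟩ : ∃ T, T = κ / k * (Real.exp k - 1) := ⟨_, rfl⟩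
  have hT0 : 0 ≤ T := by
    rw [hT]
    exact mul_nonneg (by positivity) (by linarith [Real.add_one_le_exp k])
  obtain ⟨ε, hε0, hε1, hεη⟩ : ∃ ε : ℝ, 0 < ε ∧ ε ≤ 1 ∧ T * ε ≤ η := by
    -- The denominator is `T + 1` because `T` may vanish.
    refine ⟨min 1 (η / (T + 1)), lt_min one_pos (by positivity), min_le_left _ _, ?_⟩
    refine (mul_le_mul_of_nonneg_left (min_le_right _ _) hT0).trans ?_
    rw [mul_div_assoc', div_le_iff₀ (by positivity)]
    nlinarith
  obtain ⟨δ, hδ, htaylor⟩ := uniform_taylor_on_compact hV hVc ha hK hKV hε0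
  have hVp : ∀ᶠ v in 𝓝 (0 : E), p + v ∈ V :=
    (continuous_const.add continuous_id).continuousAt.eventually
      (by simpa using hV.mem_nhds hp)
  filter_upwards [hVp, Metric.ball_mem_nhds (0 : E) hδ, Metric.ball_mem_nhds (0 : E) hε0]
    with v hvV hvδ hvε
  rw [mem_ball_zero_iff] at hvδ hvε
  have hpv : ∀ t : ℝ, p₀ + t • (p + v - p₀) = c t + t • v := fun t => by
    simp only [c, hd]; module
  have hpv' : p + v - p₀ = d + v := by rw [hd]; abel
  have htv : ∀ t ∈ Icc (0 : ℝ) 1, ‖t • v‖ ≤ ‖v‖ := fun t ht =>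
    norm_smul_le_of_mem_unitInterval ht v
  have htay : ∀ t ∈ Icc (0 : ℝ) 1,
      ‖a (c t + t • v) - a (c t) - fderiv ℝ a (c t) (t • v)‖ ≤ ε * ‖t • v‖ := fun t ht =>
    htaylor _ (mem_image_of_mem c ht) _ (hpv t ▸ hc _ hvV t ht) ((htv t ht).trans_lt hvδ)
  -- First-order guess for the transport along the ray to `p + v`, displaced by `t • v` from the ray
  -- to `p`. At `t = 1` it is `Y p 1` plus the claimed derivative applied to `v`. It has the right
  -- value at `t = 0` and solves the displaced equation up to `κ ε ‖v‖`, so Grönwall bounds its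
  -- distance from the true transport by `T ε ‖v‖`.
  let R : ℝ → F := fun t => Y p t - t • a (c t) v (Y p t)
  let R' : ℝ → F := fun t => -(a (c t) d (Y p t)) - a (c t) v (Y p t)
    - t • fderiv ℝ a (c t) d v (Y p t) + t • a (c t) v (a (c t) d (Y p t))
  have hR : ∀ t ∈ Icc (0 : ℝ) 1, HasDerivWithinAt R (R' t) (Icc 0 1) t := fun t ht => by
    have hYt : HasDerivWithinAt (Y p) (-(a (c t) d (Y p t))) (Icc 0 1) t := hY p hp t ht
    have hct : HasDerivWithinAt c d (Icc 0 1) t :=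
      (((hasDerivWithinAt_id t _).smul_const d).const_add p₀).congr_deriv (one_smul _ _)
    have hat : HasDerivWithinAt (fun τ => a (c τ)) (fderiv ℝ a (c t) d) (Icc 0 1) t :=
      (had _ (hcV t ht)).comp_hasDerivWithinAt t hct
    have h := hYt.sub ((hasDerivWithinAt_id t _).smul
      ((hat.clm_apply (hasDerivWithinAt_const t _ v)).clm_apply hYt))
    refine h.congr_deriv ?_
    simp [R']
    abel
  have hbound : ∀ t ∈ Icc (0 : ℝ) 1,
      ‖R' t + a (c t + t • v) (d + v) (R t)‖ ≤ κ * (ε * ‖v‖) := fun t ht => by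
    rw [hκ]
    refine norm_parallel_defect_le ht ?_ (hA _ (mem_image_of_mem c ht))
      (hC _ (mem_image_of_mem c ht)) (hM t ht) hL.ge hvε.le hε1 (htay t ht)
    have := hflat _ (hcV t ht) v d
    rwa [formCurvature, extD_apply (had _ (hcV t ht)).differentiableAt] at this
  have hlip : ∀ t ∈ Icc (0 : ℝ) 1, ‖a (c t + t • v) (d + v)‖ ≤ k := fun t ht => by
    have h1 : ‖a (c t + t • v)‖ ≤ A + C + 1 := by
      have heq : a (c t + t • v) = a (c t) + fderiv ℝ a (c t) (t • v)
          + (a (c t + t • v) - a (c t) - fderiv ℝ a (c t) (t • v)) := by abel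
      rw [heq]
      have hv1 : ‖t • v‖ ≤ 1 := (htv t ht).trans (hvε.le.trans hε1)
      refine norm_add_le_of_le (norm_add_le_of_le (hA _ (mem_image_of_mem c ht)) ?_)
        ((htay t ht).trans ?_)
      · exact (ContinuousLinearMap.le_of_opNorm_le_of_le _ (hC _ (mem_image_of_mem c ht)) hv1).trans
          (mul_one C).le
      · exact mul_le_one₀ hε1 (norm_nonneg _) hv1
    rw [hk]
    exact ContinuousLinearMap.le_of_opNorm_le_of_le _ h1
      (norm_add_le_of_le hL.ge (hvε.le.trans hε1))
  have hZ : ∀ t ∈ Icc (0 : ℝ) 1, HasDerivWithinAt (fun τ => Y (p + v) τ - R τ)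
      (-(a (c t + t • v) (d + v) (Y (p + v) t)) - R' t) (Icc 0 1) t := fun t ht => by
    have := (hY _ hvV t ht).sub (hR t ht)
    rwa [hpv, hpv'] at this
  have hgr := norm_le_gronwallBound_of_norm_deriv_right_le (δ := 0) (K := k)
    (ε := κ * (ε * ‖v‖)) (fun t ht => (hZ t ht).continuousWithinAt)
    (fun t ht => (hZ t (Ico_subset_Icc_self ht)).mono_of_mem_nhdsWithin
      (Icc_mem_nhdsGE_of_mem ht))
    (by simp [R, hY0 _ hvV, hY0 _ hp])
    (fun t ht => by
      have ht' := Ico_subset_Icc_self ht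
      have heq : -(a (c t + t • v) (d + v) (Y (p + v) t)) - R' t =
          -(a (c t + t • v) (d + v) (Y (p + v) t - R t))
            - (R' t + a (c t + t • v) (d + v) (R t)) := by
        rw [map_sub]; abel
      rw [heq]
      refine norm_sub_le_of_le ?_ (hbound t ht')
      rw [norm_neg]
      exact ContinuousLinearMap.le_of_opNorm_le _ (hlip t ht') _) 1 h11
  have hc1 : c 1 = p := by simp [c, hd]
  have hR1 : Y (p + v) 1 - R 1 = Y (p + v) 1 - Y p 1 - (-(a p).flip (Y p 1)) v := by
    simp [R, hc1]
    abel
  rw [hR1, gronwallBound_of_K_ne_0 hk0.ne'] at hgr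
  refine hgr.trans ?_
  calc _ = T * ε * ‖v‖ := by rw [hT]; simp; ring
    _ ≤ η * ‖v‖ := mul_le_mul_of_nonneg_right hεη (norm_nonneg _)

/-- A flat linear connection over a convex open set has parallel sections with arbitrary initial
values. -/
theorem exists_parallel_of_flat {ι : Type*} [Fintype ι]
    {a : E → (E →L[ℝ] ((ι → ℝ) →L[ℝ] (ι → ℝ)))} {V : Set E}
    (hV : IsOpen V) (hVc : Convex ℝ V) (ha : ContDiffOn ℝ 1 a V)
    (hflat : ∀ p ∈ V, ∀ v w : E, formCurvature a p v w = 0) {p₀ : E} (hp₀ : p₀ ∈ V)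
    (X₀ : ι → ℝ) :
    ∃ X : E → ι → ℝ, X p₀ = X₀ ∧ ∀ p ∈ V, HasFDerivAt X (-(a p).flip (X p)) p := by
  have hex : ∀ p ∈ V, ∃ Y : ℝ → ι → ℝ, Y 0 = X₀ ∧ ∀ t ∈ Icc (0 : ℝ) 1,
      HasDerivWithinAt Y (-(a (p₀ + t • (p - p₀)) (p - p₀) (Y t))) (Icc 0 1) t := fun p hp => by
    refine exists_linear_ode (fun t => -(a (p₀ + t • (p - p₀)) (p - p₀))) ?_ X₀
    have hc : ContinuousOn (fun t : ℝ => p₀ + t • (p - p₀)) (Icc 0 1) := by fun_prop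
    exact ((ha.continuousOn.comp hc fun t ht => hVc.add_smul_sub_mem hp₀ hp ht).clm_apply
      continuousOn_const).neg
  choose! Y hY0 hY using hex
  refine ⟨fun q => Y q 1, ?_,
    fun p hp => hasFDerivAt_of_radially_parallel hV hVc ha hflat hp₀ hY0 hY hp⟩
  -- The ray from `p₀` to itself has zero velocity, so transport along it is constant.
  have hconst := constant_of_derivWithin_zero (f := Y p₀) (a := 0) (b := 1)
    (fun t ht => (hY p₀ hp₀ t ht).differentiableWithinAt)
    (fun t ht => by
      have ht' := Ico_subset_Icc_self ht
      rw [(hY p₀ hp₀ t ht').derivWithin (uniqueDiffOn_Icc one_pos t ht')]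
      simp) 1 (by simp)
  exact hconst.trans (hY0 p₀ hp₀)

end Parallel

/-! ### Jets of smooth functions -/

theorem contDiffOn_partialDeriv {f : Base → ℝ} {D : Set Base} (hD : IsOpen D)
    (hf : ContDiffOn ℝ ∞ f D) (k : Fin 2) : ContDiffOn ℝ ∞ (partialDeriv k f) D :=
  (hf.fderiv_of_isOpen hD (m := ∞) (by simp)).clm_apply contDiffOn_const

theorem contDiffOn_partialDeriv_iterate {f : Base → ℝ} {D : Set Base} (hD : IsOpen D)
    (hf : ContDiffOn ℝ ∞ f D) (k : Fin 2) (n : ℕ) :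
    ContDiffOn ℝ ∞ ((partialDeriv k)^[n] f) D := by
  induction n with
  | zero => exact hf
  | succ n ih =>
    rw [Function.iterate_succ_apply']
    exact contDiffOn_partialDeriv hD ih k

theorem partialDeriv_congr {f g : Base → ℝ} {D : Set Base} (hD : IsOpen D) (h : EqOn f g D)
    (k : Fin 2) : EqOn (partialDeriv k f) (partialDeriv k g) D := fun p hp => by
  rw [partialDeriv, partialDeriv, (h.eventuallyEq_of_mem (hD.mem_nhds hp)).fderiv_eq]

theorem partialDeriv_comm {f : Base → ℝ} {D : Set Base} (hD : IsOpen D)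
    (hf : ContDiffOn ℝ ∞ f D) (k l : Fin 2) :
    EqOn (partialDeriv k (partialDeriv l f)) (partialDeriv l (partialDeriv k f)) D :=
    fun p hp => by
  have hp' : ContDiffAt ℝ ∞ f p := hf.contDiffAt (hD.mem_nhds hp)
  have hd : DifferentiableAt ℝ (fderiv ℝ f) p :=
    (hp'.fderiv_right (m := 1) (by norm_cast)).differentiableAt (by norm_num)
  have key : ∀ x y : Base, fderiv ℝ (fun q => fderiv ℝ f q x) p y =
      fderiv ℝ (fderiv ℝ f) p y x := fun x y => by
    rw [fderiv_clm_apply hd (differentiableAt_const x)]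
    simp
  unfold partialDeriv
  rw [key, key]
  exact hp'.isSymmSndFDerivAt (by simp; norm_cast) _ _

/-- In `jet` the `x`-derivatives are applied last, so an additional `y`-derivative has to be moved
past them to raise the second index. -/
theorem partialDeriv_iterate_comm {f : Base → ℝ} {D : Set Base} (hD : IsOpen D)
    (hf : ContDiffOn ℝ ∞ f D) (k l : Fin 2) (n : ℕ) :
    EqOn (partialDeriv k ((partialDeriv l)^[n] f)) ((partialDeriv l)^[n] (partialDeriv k f)) D := by
  induction n with
  | zero => exact fun _ _ => rfl
  | succ n ih =>
    rw [Function.iterate_succ_apply', Function.iterate_succ_apply']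
    exact (partialDeriv_comm hD (contDiffOn_partialDeriv_iterate hD hf l n) k l).trans
      (partialDeriv_congr hD ih l)

theorem contDiffOn_jet (r : ℕ) {u : Base → ℝ} {D : Set Base} (hD : IsOpen D)
    (hu : ContDiffOn ℝ ∞ u D) : ContDiffOn ℝ ∞ (jet r u) D :=
  contDiffOn_id.prodMk (contDiffOn_pi.2 fun α => contDiffOn_partialDeriv_iterate hD
    (contDiffOn_partialDeriv_iterate hD hu 1 α.1.2) 0 α.1.1)

/-- The lift of a section is tangent to the total derivatives. -/
theorem fderiv_jet_basisVec {r : ℕ} {u : Base → ℝ} {D : Set Base} (hD : IsOpen D)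
    (hu : ContDiffOn ℝ ∞ u D) {p : Base} (hp : p ∈ D) (k : Fin 2) :
    fderiv ℝ (jet r u) p (basisVec k) = totalDeriv k (jet (r + 1) u p) := by
  have hcomp : ∀ α : MultiIndex r, DifferentiableAt ℝ
      ((partialDeriv 0)^[α.1.1] ((partialDeriv 1)^[α.1.2] u)) p := fun α =>
    ((contDiffOn_partialDeriv_iterate hD (contDiffOn_partialDeriv_iterate hD hu 1 α.1.2) 0
      α.1.1).contDiffAt (hD.mem_nhds hp)).differentiableAt (by simp)
  have h := ((hasFDerivAt_id p).prodMk
    (hasFDerivAt_pi.2 fun α => (hcomp α).hasFDerivAt)).fderiv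
  have h' : fderiv ℝ (jet r u) p = _ := h
  rw [h']
  refine Prod.ext rfl (funext fun α => ?_)
  change partialDeriv k ((partialDeriv 0)^[α.1.1] ((partialDeriv 1)^[α.1.2] u)) p =
    (partialDeriv 0)^[(α.bump k).1.1] ((partialDeriv 1)^[(α.bump k).1.2] u) p
  fin_cases k
  · have h1 : (α.bump 0).1 = (α.1.1 + 1, α.1.2) := rfl
    change partialDeriv 0 _ p = (partialDeriv 0)^[(α.bump 0).1.1]
      ((partialDeriv 1)^[(α.bump 0).1.2] u) p
    rw [h1, Function.iterate_succ_apply']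
  · have h1 : (α.bump 1).1 = (α.1.1, α.1.2 + 1) := rfl
    change partialDeriv 1 _ p = (partialDeriv 0)^[(α.bump 1).1.1]
      ((partialDeriv 1)^[(α.bump 1).1.2] u) p
    rw [h1, Function.iterate_succ_apply']
    exact partialDeriv_iterate_comm hD (contDiffOn_partialDeriv_iterate hD hu 1 _) 1 0 _ hp

theorem eq_sum_basisVec (v : Base) : v = v.1 • basisVec 0 + v.2 • basisVec 1 := by
  simp [basisVec]

theorem clm_ext_basisVec {F : Type*} [NormedAddCommGroup F] [NormedSpace ℝ F]
    {S T : Base →L[ℝ] F} (h : ∀ k, S (basisVec k) = T (basisVec k)) : S = T := by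
  refine ContinuousLinearMap.ext fun v => ?_
  rw [eq_sum_basisVec v]
  simp only [map_add, map_smul, h]

/-! ### Principal connections -/

section Connection

variable {G : Subgroup GL2} {r : ℕ} {U : Set (Jet r)}

theorem zero_mem_lieAlg (G : Subgroup GL2) : (0 : Mat) ∈ lieAlg G := fun t =>
  ⟨1, G.one_mem, by simp⟩

theorem contDiffOn_connCoeff (ϖ : PrincipalConnection G U) : ContDiffOn ℝ ∞ (connCoeff ϖ) U := by
  have h : ContDiffOn ℝ ∞ (fun z : Jet r => ((z, 1) : Jet r × Mat)) U :=
    contDiffOn_id.prodMk contDiffOn_const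
  exact (ϖ.smooth.comp h fun z hz => ⟨hz, isUnit_one⟩).clm_comp contDiffOn_const

theorem contDiffOn_laxCoeff (ϖ : PrincipalConnection G U) (k : Fin 2) :
    ContDiffOn ℝ ∞ (laxCoeff ϖ k) {z | jetProj z ∈ U} := by
  have hproj : ContDiff ℝ ∞ (jetProj : Jet (r + 1) → Jet r) :=
    contDiff_fst.prodMk (contDiff_pi.2 fun α => by fun_prop)
  have htot : ContDiff ℝ ∞ (totalDeriv k : Jet (r + 1) → Jet r) :=
    contDiff_const.prodMk (contDiff_pi.2 fun α => by fun_prop)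
  exact ((contDiffOn_connCoeff ϖ).comp hproj.contDiffOn fun z hz => hz).clm_apply htot.contDiffOn

theorem laxCoeff_mem_lieAlg (ϖ : PrincipalConnection G U) (k : Fin 2) {z : Jet (r + 1)}
    (hz : jetProj z ∈ U) : laxCoeff ϖ k z ∈ lieAlg G := by
  -- At `g = 1` with vertical component zero, the reduction condition speaks of the connection
  -- coefficients themselves.
  have := ϖ.reduces _ hz 1 G.one_mem (totalDeriv k z) 0 (zero_mem_lieAlg G)
  simpa [laxCoeff, connCoeff] using this

/-- The connection form is determined by the connection coefficients. -/
theorem form_apply (ϖ : PrincipalConnection G U) {z : Jet r} (hz : z ∈ U) (g : GL2) (ζ : Jet r)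
    (B : Mat) : ϖ.form (z, (g : Mat)) (ζ, B) =
      ((g⁻¹ : GL2) : Mat) * connCoeff ϖ z ζ * (g : Mat) + ((g⁻¹ : GL2) : Mat) * B := by
  have h1 := ϖ.equivariant z hz 1 g ζ 0
  have h2 := ϖ.vertical z hz g (((g⁻¹ : GL2) : Mat) * B)
  rw [← mul_assoc, Units.mul_inv, one_mul] at h2
  rw [Units.val_one, one_mul, zero_mul] at h1
  have h3 : ((ζ, B) : Jet r × Mat) = (ζ, 0) + (0, B) := by simp
  rw [h3, map_add, h1, h2]
  rfl

/-- The curvature form in terms of the curvature of the connection coefficients. -/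
theorem curvature_apply (hU : IsOpen U) (ϖ : PrincipalConnection G U) {z : Jet r} (hz : z ∈ U)
    (g : GL2) (V W : Jet r × Mat) : curvature ϖ (z, (g : Mat)) V W =
      ((g⁻¹ : GL2) : Mat) * formCurvature (connCoeff ϖ) z V.1 W.1 * (g : Mat) := by
  have hopen : IsOpen (U ×ˢ {g : Mat | IsUnit g}) := hU.prod Units.isOpen
  have hmem : (z, (g : Mat)) ∈ U ×ˢ {g : Mat | IsUnit g} := ⟨hz, g.isUnit⟩
  have hform : DifferentiableAt ℝ ϖ.form (z, (g : Mat)) :=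
    (ϖ.smooth.contDiffAt (hopen.mem_nhds hmem)).differentiableAt (by simp)
  have hconn : DifferentiableAt ℝ (connCoeff ϖ) z :=
    ((contDiffOn_connCoeff ϖ).contDiffAt (hU.mem_nhds hz)).differentiableAt (by simp)
  have hder : ∀ V W : Jet r × Mat, fderiv ℝ ϖ.form (z, (g : Mat)) V W =
      -(((g⁻¹ : GL2) : Mat) * V.2 * ((g⁻¹ : GL2) : Mat) * connCoeff ϖ z W.1 * (g : Mat)) +
        ((g⁻¹ : GL2) : Mat) * fderiv ℝ (connCoeff ϖ) z V.1 W.1 * (g : Mat) +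
        ((g⁻¹ : GL2) : Mat) * connCoeff ϖ z W.1 * V.2 -
        ((g⁻¹ : GL2) : Mat) * V.2 * ((g⁻¹ : GL2) : Mat) * W.2 := fun V W => by
    have h1 : fderiv ℝ (fun q => ϖ.form q W) (z, (g : Mat)) V =
        fderiv ℝ ϖ.form (z, (g : Mat)) V W := by
      rw [fderiv_clm_apply hform (differentiableAt_const W)]
      simp
    -- Near the point the form equals `g⁻¹ Γ g + g⁻¹ dg`; `Ring.inverse` extends inversion to all of
    -- `Mat`, so the formula can be differentiated there.
    have heq : (fun q => ϖ.form q W) =ᶠ[𝓝 (z, (g : Mat))] fun q =>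
        Ring.inverse q.2 * connCoeff ϖ q.1 W.1 * q.2 + Ring.inverse q.2 * W.2 := by
      filter_upwards [hopen.mem_nhds hmem] with q hq
      obtain ⟨h, hh⟩ := hq.2
      have := form_apply ϖ hq.1 h W.1 W.2
      rw [hh] at this
      rw [← hh, Ring.inverse_unit, hh, ← this]
    have hinv : HasFDerivAt (fun q : Jet r × Mat => Ring.inverse q.2)
        ((-ContinuousLinearMap.mulLeftRight ℝ Mat ((g⁻¹ : GL2) : Mat) ((g⁻¹ : GL2) : Mat)).comp
          (ContinuousLinearMap.snd ℝ (Jet r) Mat)) (z, (g : Mat)) :=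
      HasFDerivAt.comp (g := Ring.inverse) (f := Prod.snd) (z, (g : Mat))
        (hasFDerivAt_ringInverse (𝕜 := ℝ) g) hasFDerivAt_snd
    have hcz : HasFDerivAt (fun q : Jet r × Mat => connCoeff ϖ q.1)
        ((fderiv ℝ (connCoeff ϖ) z).comp (ContinuousLinearMap.fst ℝ (Jet r) Mat)) (z, (g : Mat)) :=
      HasFDerivAt.comp (g := connCoeff ϖ) (f := Prod.fst) (z, (g : Mat)) hconn.hasFDerivAt
        hasFDerivAt_fst
    have hc : HasFDerivAt (fun q : Jet r × Mat => connCoeff ϖ q.1 W.1) _ (z, (g : Mat)) :=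
      hcz.clm_apply (hasFDerivAt_const W.1 _)
    have h2 := ((hinv.mul' hc).mul' hasFDerivAt_snd).add (hinv.mul' (hasFDerivAt_const W.2 _))
    rw [← h1, heq.fderiv_eq]
    refine (congrArg (fun T => T V) h2.fderiv).trans ?_
    simp
    noncomm_ring
  have hmg : ∀ T : Mat, (g : Mat) * (((g⁻¹ : GL2) : Mat) * T) = T := fun T => by
    rw [← mul_assoc, Units.mul_inv, one_mul]
  obtain ⟨V₁, V₂⟩ := V
  obtain ⟨W₁, W₂⟩ := W
  rw [curvature, extD_apply hform, hder, hder, form_apply ϖ hz, form_apply ϖ hz, formCurvature,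
    extD_apply hconn]
  simp only [mul_add, add_mul, mul_sub, sub_mul, mul_assoc, hmg]
  abel

/-- The connection form of the linear connection on the base that a section induces. -/
def sectionForm (ϖ : PrincipalConnection G U) (u : Base → ℝ) : Base → (Base →L[ℝ] Mat) :=
  pullback (jet r u) (connCoeff ϖ)

variable {s : ℕ} {W : Set (Jet s)} {u : Base → ℝ} {D : Set Base}

theorem IsSection.contDiffOn_jet (hu : IsSection U W u D) (n : ℕ) : ContDiffOn ℝ ∞ (jet n u) D :=
  ZeroCurvature.contDiffOn_jet n hu.isOpen hu.smooth

theorem IsSection.contDiffAt_jet (hu : IsSection U W u D) (n : ℕ) {p : Base} (hp : p ∈ D) :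
    ContDiffAt ℝ ∞ (jet n u) p :=
  (hu.contDiffOn_jet n).contDiffAt (hu.isOpen.mem_nhds hp)

theorem IsSection.contDiffOn_sectionForm (hu : IsSection U W u D) (ϖ : PrincipalConnection G U) :
    ContDiffOn ℝ ∞ (sectionForm ϖ u) D :=
  ((contDiffOn_connCoeff ϖ).comp (hu.contDiffOn_jet r) hu.mem_left).clm_comp
    ((hu.contDiffOn_jet r).fderiv_of_isOpen hu.isOpen (by simp))

/-- The curvature is horizontal and conjugated by `g`, so the vertical components `A`, `B` are
irrelevant and the test at `g = 1`, `A = B = 0` already decides. -/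
theorem IsSection.curvatureVanishesOn_iff (hU : IsOpen U) (hu : IsSection U W u D)
    (ϖ : PrincipalConnection G U) : CurvatureVanishesOn ϖ u D ↔
      ∀ p ∈ D, ∀ v w : Base, formCurvature (sectionForm ϖ u) p v w = 0 := by
  have hpull : ∀ p ∈ D, ∀ v w : Base, formCurvature (sectionForm ϖ u) p v w =
      formCurvature (connCoeff ϖ) (jet r u p) (fderiv ℝ (jet r u) p v)
        (fderiv ℝ (jet r u) p w) := fun p hp v w =>
    formCurvature_pullback ((hu.contDiffAt_jet r hp).of_le (by norm_cast))
      (((contDiffOn_connCoeff ϖ).contDiffAt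
        (hU.mem_nhds (hu.mem_left p hp))).differentiableAt (by simp)) v w
  constructor
  · intro h p hp v w
    have := h p hp 1 G.one_mem v w 0 (zero_mem_lieAlg G) 0 (zero_mem_lieAlg G)
    rw [curvature_apply hU ϖ (hu.mem_left p hp)] at this
    rw [hpull p hp]
    simpa using this
  · intro h p hp g _ v w A _ B _
    rw [curvature_apply hU ϖ (hu.mem_left p hp), ← hpull p hp, h p hp, mul_zero, zero_mul]

theorem IsSection.assocFormOn_eqOn (hu : IsSection U W u D) (ϖ : PrincipalConnection G U) :
    EqOn (assocFormOn ϖ u) (linearForm (sectionForm ϖ u)) (D ×ˢ univ) := by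
  rintro ⟨p, X⟩ ⟨hp, -⟩
  have hj : HasFDerivAt (jet r u) (fderiv ℝ (jet r u) p) p :=
    ((hu.contDiffAt_jet r hp).differentiableAt (by simp)).hasFDerivAt
  have hj' : HasFDerivAt (fun q : Base × Fibre => jet r u q.1)
      ((fderiv ℝ (jet r u) p).comp (ContinuousLinearMap.fst ℝ Base Fibre)) (p, X) :=
    HasFDerivAt.comp (g := jet r u) (f := Prod.fst) (p, X) hj hasFDerivAt_fst
  have h : fderiv ℝ (fun q : Base × Fibre => (jet r u q.1, q.2)) (p, X) = _ :=
    (hj'.prodMk hasFDerivAt_snd).fderiv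
  refine ContinuousLinearMap.ext fun V => ?_
  rw [assocFormOn, pullback, h]
  simp [assocForm, sectionForm, pullback]

theorem IsSection.isCompletelyIntegrable_assocFormOn_iff (hu : IsSection U W u D)
    (ϖ : PrincipalConnection G U) : IsCompletelyIntegrable (assocFormOn ϖ u) (D ×ˢ univ) ↔
      ∀ p ∈ D, ∀ v w : Base, formCurvature (sectionForm ϖ u) p v w = 0 := by
  rw [← isCompletelyIntegrable_linearForm_iff hu.isOpen (hu.contDiffOn_sectionForm ϖ)]
  have heq := hu.assocFormOn_eqOn ϖ
  have hd : ∀ q ∈ D ×ˢ (univ : Set Fibre), ∀ V V' : Base × Fibre,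
      extD (assocFormOn ϖ u) q V V' = extD (linearForm (sectionForm ϖ u)) q V V' :=
    fun q hq => extD_congr (heq.eventuallyEq_of_mem ((hu.isOpen.prod isOpen_univ).mem_nhds hq))
  refine exists_congr fun η => and_congr_right fun _ => forall₂_congr fun q hq => ?_
  rw [heq hq]
  simp only [hd q hq]

theorem IsSection.sectionForm_basisVec (hu : IsSection U W u D) (ϖ : PrincipalConnection G U)
    {p : Base} (hp : p ∈ D) (k : Fin 2) :
    sectionForm ϖ u p (basisVec k) = laxCoeff ϖ k (jet (r + 1) u p) := by
  rw [sectionForm, pullback, ContinuousLinearMap.comp_apply,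
    fderiv_jet_basisVec hu.isOpen hu.smooth hp]
  rfl

/-- Solutions of the Lax system are parallel sections. -/
theorem IsSection.solvesLax_iff (hu : IsSection U W u D) (ϖ : PrincipalConnection G U)
    {V : Set Base} (hV : V ⊆ D) {X : Base → Fibre} : SolvesLax ϖ u V X ↔
      ∀ p ∈ V, HasFDerivAt X (-(sectionForm ϖ u p).flip (X p)) p := by
  refine forall₂_congr fun p hp => ?_
  constructor
  · rintro ⟨hX, h⟩
    refine hX.hasFDerivAt.congr_fderiv (clm_ext_basisVec fun k => ?_)
    rw [h, ← hu.sectionForm_basisVec ϖ (hV hp)]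
    rfl
  · intro h
    refine ⟨h.differentiableAt, fun k => ?_⟩
    rw [h.fderiv, ← hu.sectionForm_basisVec ϖ (hV hp)]
    rfl

/-- The pull-back of `dX + a X` to the graph is the derivative of `X` plus `a` applied to `X`. -/
theorem IsSection.pullback_graph_eq_zero_iff (hu : IsSection U W u D)
    (ϖ : PrincipalConnection G U) {V : Set Base} (hV : V ⊆ D) {X : Base → Fibre}
    (hX : ∀ p ∈ V, DifferentiableAt ℝ X p) :
    (∀ p ∈ V, pullback (fun p' => (p', X p')) (assocFormOn ϖ u) p = 0) ↔ SolvesLax ϖ u V X := by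
  rw [hu.solvesLax_iff ϖ hV]
  refine forall₂_congr fun p hp => ?_
  have hXp := (hX p hp).hasFDerivAt
  have hg : fderiv ℝ (fun p' => (p', X p')) p = _ := ((hasFDerivAt_id p).prodMk hXp).fderiv
  have heq : pullback (fun p' => (p', X p')) (assocFormOn ϖ u) p =
      fderiv ℝ X p + (sectionForm ϖ u p).flip (X p) := by
    refine ContinuousLinearMap.ext fun v => ?_
    rw [pullback, hg, hu.assocFormOn_eqOn ϖ ⟨hV hp, mem_univ _⟩]
    simp
  rw [heq, add_eq_zero_iff_eq_neg]
  exact ⟨fun h => h ▸ hXp, fun h => h.fderiv⟩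

theorem IsSection.laxSolvableForAllData_iff (hu : IsSection U W u D)
    (ϖ : PrincipalConnection G U) : LaxSolvableForAllData ϖ u D ↔
      ∀ p ∈ D, ∀ v w : Base, formCurvature (sectionForm ϖ u) p v w = 0 := by
  have hsm := hu.contDiffOn_sectionForm ϖ
  constructor
  · intro h p hp v w
    obtain ⟨ε, hε, hball⟩ := Metric.isOpen_iff.1 hu.isOpen p hp
    -- The curvature is tested on an arbitrary vector `X₀`, which a solution on a ball around `p`
    -- attains at `p`.
    ext1 X₀
    obtain ⟨X, hXp, hX⟩ := h _ hball Metric.isOpen_ball (convex_ball p ε) p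
      (Metric.mem_ball_self hε) X₀
    rw [hu.solvesLax_iff ϖ hball] at hX
    rw [← hXp]
    exact formCurvature_apply_eq_zero
      ((hsm.contDiffAt (hu.isOpen.mem_nhds hp)).differentiableAt (by simp))
      (by filter_upwards [Metric.ball_mem_nhds p hε] with q hq using hX q hq) v w
  · intro h V hVD hV hVc p₀ hp₀ X₀
    obtain ⟨X, hX0, hX⟩ := exists_parallel_of_flat hV hVc ((hsm.mono hVD).of_le (by norm_cast))
      (fun p hp => h p (hVD hp)) hp₀ X₀
    exact ⟨X, hX0, (hu.solvesLax_iff ϖ hVD).2 hX⟩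

end Connection

end ZeroCurvature

end

open ZeroCurvature
theorem theorem5p1 (r s : ℕ) (G : Subgroup GL2) (U : Set (Jet r)) (hU : IsOpen U)
    (ϖ : PrincipalConnection G U) (W : Set (Jet s)) (Φ : Jet s → ℝ)
    (hϖ : IsZeroCurvatureRep ϖ W Φ) :
    (∀ k : Fin 2, ContDiffOn ℝ ∞ (laxCoeff ϖ k) {z | jetProj z ∈ U} ∧
      ∀ z, jetProj z ∈ U → laxCoeff ϖ k z ∈ lieAlg G) ∧
    ∀ (u : Base → ℝ) (D : Set Base), IsSection U W u D →
      (∀ V ⊆ D, IsOpen V → ∀ X : Base → Fibre, (∀ p ∈ V, DifferentiableAt ℝ X p) →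
        ((∀ p ∈ V, pullback (fun p' => (p', X p')) (assocFormOn ϖ u) p = 0) ↔
          SolvesLax ϖ u V X)) ∧
      (IsCompletelyIntegrable (assocFormOn ϖ u) (D ×ˢ Set.univ) ↔ SolvesPDE Φ u D) ∧
      (LaxSolvableForAllData ϖ u D ↔ SolvesPDE Φ u D) := by
  refine ⟨fun k => ⟨contDiffOn_laxCoeff ϖ k, fun z hz => laxCoeff_mem_lieAlg ϖ k hz⟩,
    fun u D hu => ⟨fun V hV _ X hX => hu.pullback_graph_eq_zero_iff ϖ hV hX, ?_, ?_⟩⟩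
  · rw [hu.isCompletelyIntegrable_assocFormOn_iff, ← hu.curvatureVanishesOn_iff hU, hϖ u D hu]
  · rw [hu.laxSolvableForAllData_iff, ← hu.curvatureVanishesOn_iff hU, hϖ u D hu]
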